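/- Let $B_2(x)=\max(1-|x|,0)$, $x\in\mathbb{R}$, be the $2$-spline. For $a,b>0$ let $\mathcal{G}(B_2,a,b)=\{x\mapsto e^{2\pi i\ell b x}B_2(x-ka) : (\ell,k)\in\mathbb{Z}^2\}$, and call it a frame for $L^2(\mathbb{R})$ if there are constants $A,B>0$ such that $$A\|f\|_2^2\le\sum_{\ell,k\in\mathbb{Z}}\Big|\int_{\mathbb{R}} f(x)\,e^{-2\pi i\ell b x}B_2(x-ka)\,dx\Big|^2\le B\|f\|_2^2\qquad\text{for all } f\in L^2(\mathbb{R}).$$ Then: (a) for every integer $j\ge1$, $\mathcal{G}\left(B_2,\frac{1}{2^j},\frac32\right)$ is a frame for $L^2(\mathbb{R})$; (b) for every integer $j\ge3$, $\mathcal{G}\left(B_2,\frac{3}{2^j},\frac32\right)$ is a frame for $L^2(\mathbb{R})$. -/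

import Mathlib

open MeasureTheory

noncomputable section

/-- A family `e` in a Hilbert space is a frame if there are `A, B > 0` such that
`A ‖f‖² ≤ ∑ |⟨f, e i⟩|² ≤ B ‖f‖²` for every `f`; convergence of the sum is part of the claim. -/
def IsFrame {ι H : Type*} [NormedAddCommGroup H] [InnerProductSpace ℂ H] (e : ι → H) : Prop :=
  ∃ A B : ℝ, 0 < A ∧ 0 < B ∧ ∀ f : H,
    Summable (fun i => ‖inner ℂ (e i) f‖ ^ 2) ∧
      A * ‖f‖ ^ 2 ≤ ∑' i, ‖inner ℂ (e i) f‖ ^ 2 ∧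
      ∑' i, ‖inner ℂ (e i) f‖ ^ 2 ≤ B * ‖f‖ ^ 2

/-- The time-frequency shift `M_ω T_t g : x ↦ exp(2π i ω x) g(x - t)`. -/
def timeFreqShift (g : ℝ → ℂ) (ω t : ℝ) (x : ℝ) : ℂ :=
  Complex.exp (2 * Real.pi * Complex.I * ω * x) * g (x - t)

theorem timeFreqShift_memLp {g : ℝ → ℂ} (hg : MemLp g 2 volume) (ω t : ℝ) :
    MemLp (timeFreqShift g ω t) 2 volume := by
  have h1 : MemLp (fun x => g (x - t)) 2 volume :=
    hg.comp_measurePreserving (measurePreserving_sub_right volume t)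
  have hc : Continuous fun x : ℝ => Complex.exp (2 * Real.pi * Complex.I * ω * x) := by
    fun_prop
  refine (memLp_congr_norm (hc.aestronglyMeasurable.mul h1.1) h1.1 ?_).2 h1
  filter_upwards with x
  have h : (2 * Real.pi * Complex.I * ω * x : ℂ) = ((2 * Real.pi * ω * x : ℝ) : ℂ) * Complex.I := by
    push_cast
    ring
  simp only [Pi.mul_apply, norm_mul]
  rw [h, Complex.norm_exp_ofReal_mul_I, one_mul]

/-- The Gabor system `G(g, a, b) = {M_{ℓ b} T_{k a} g : (ℓ, k) ∈ ℤ²}` in `L²(ℝ)`. -/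
def gaborSystem (g : ℝ → ℂ) (hg : MemLp g 2 volume) (a b : ℝ) (i : ℤ × ℤ) :
    Lp ℂ 2 (volume : Measure ℝ) :=
  (timeFreqShift_memLp hg (i.1 * b) (i.2 * a)).toLp (timeFreqShift g (i.1 * b) (i.2 * a))

/-- The 2-spline `B₂(x) = max(1 - |x|, 0)`, as a complex-valued function. -/
def B₂ (x : ℝ) : ℂ := (max (1 - |x|) 0 : ℝ)

theorem B₂_memLp : MemLp B₂ 2 volume := by
  have hc : Continuous B₂ := by
    unfold B₂
    fun_prop
  refine hc.memLp_of_hasCompactSupport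
    (HasCompactSupport.intro (isCompact_Icc (a := (-1 : ℝ)) (b := 1)) ?_)
  intro x hx
  have h : 1 ≤ |x| := by
    by_contra h
    exact hx (abs_le.1 (not_le.1 h).le)
  unfold B₂
  rw [max_eq_right (by linarith)]
  simp

end

open MeasureTheory

noncomputable section

/-! Modulations by multiples of 3/2 are 2/3-periodic, so the inner products of `f` with the shifts
at position `s = k a` are, up to the factor 2/3, the Fourier coefficients of the periodization
`fiberSum f s`. Parseval (`tsum_inner_gaborSystem_eq`) turns the frame sum into 2/3 times the sum
over `k` of the energies of these periodizations on one period.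

The window has support of length 2, three periods, so each periodization has at most three nonzero
terms; the upper bound follows by counting overlaps (`tsum_fiberEnergy_le`). For the lower bound,
fix `x` and regard the values of `f` on the coset of `(2/3)ℤ` through `x` as unknowns. Finitely many
neighbouring windows give a square linear system for finitely many of them, closed because each
window sees only three samples. For `a = 1/2` six windows determine six values, for `a = 3/8` four
windows determine four. Explicit elimination, with pivots bounded away from 0 uniformly in `x`,
bounds `f x` by the periodizations (`LocallyRecoverable`); squaring and integrating gives the lower
frame bound.

Refining the step from `n * a` to `a` only adds nonnegative terms, so the dyadic refinements of 1/2
and 3/8 inherit the lower bound. -/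

/-! ### Periodizations against the spline -/

/-- The `2/3`-periodization of `f · B₂(· - s)`. -/
def fiberSum (f : ℝ → ℂ) (s x : ℝ) : ℂ := ∑' n : ℤ, f (x + 2 / 3 * n) * B₂ (x + 2 / 3 * n - s)

theorem B₂_of_abs_le {u : ℝ} (h : |u| ≤ 1) : B₂ u = ((1 - |u| : ℝ) : ℂ) := by
  rw [B₂, max_eq_left (by linarith)]

theorem B₂_of_one_le_abs {u : ℝ} (h : 1 ≤ |u|) : B₂ u = 0 := by
  rw [B₂, max_eq_right (by linarith), Complex.ofReal_zero]

theorem norm_B₂_le_one (u : ℝ) : ‖B₂ u‖ ≤ 1 := by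
  rw [B₂, Complex.norm_real, Real.norm_eq_abs, abs_of_nonneg (le_max_right _ _)]
  exact max_le (by linarith [abs_nonneg u]) zero_le_one

theorem continuous_B₂ : Continuous B₂ := by
  unfold B₂
  fun_prop

/-- At most three sampling points lie in the support of the window. -/
theorem fiberSum_term_eq_zero {f : ℝ → ℂ} {s x : ℝ} {n : ℤ} (h : |x + 2 / 3 * n - s| ≤ 1 / 3)
    {m : ℤ} (hm : m ∉ Finset.Icc (n - 1) (n + 1)) :
    f (x + 2 / 3 * m) * B₂ (x + 2 / 3 * m - s) = 0 := by
  rw [B₂_of_one_le_abs, mul_zero]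
  obtain ⟨h1, h2⟩ := abs_le.1 h
  rw [Finset.mem_Icc, not_and_or, not_le, not_le] at hm
  rcases hm with hm | hm
  · have : (m : ℝ) + 2 ≤ n := by exact_mod_cast (by omega : m + 2 ≤ n)
    rw [abs_of_nonpos (by linarith)]
    linarith
  · have : (n : ℝ) + 2 ≤ m := by exact_mod_cast (by omega : n + 2 ≤ m)
    rw [abs_of_nonneg (by linarith)]
    linarith

theorem fiberSum_eq_sum (f : ℝ → ℂ) {s x : ℝ} (n : ℤ) (h : |x + 2 / 3 * n - s| ≤ 1 / 3) :
    fiberSum f s x =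
      ∑ m ∈ Finset.Icc (n - 1) (n + 1), f (x + 2 / 3 * m) * B₂ (x + 2 / 3 * m - s) :=
  tsum_eq_sum fun _ hm => fiberSum_term_eq_zero h hm

theorem exists_abs_le_third (s x : ℝ) : ∃ n : ℤ, |x + 2 / 3 * n - s| ≤ 1 / 3 := by
  refine ⟨round ((s - x) / (2 / 3)), ?_⟩
  have h := abs_le.1 (abs_sub_round ((s - x) / (2 / 3)))
  rw [abs_le]
  constructor <;> linarith [h.1, h.2]

theorem hasSum_fiberSum (f : ℝ → ℂ) (s x : ℝ) :
    HasSum (fun n : ℤ => f (x + 2 / 3 * n) * B₂ (x + 2 / 3 * n - s)) (fiberSum f s x) := by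
  obtain ⟨n, hn⟩ := exists_abs_le_third s x
  exact (summable_of_ne_finset_zero fun _ hm => fiberSum_term_eq_zero hn hm).hasSum

/-- The sample nearest to the window centre lies at offset `u`; its neighbours at `u ∓ 2/3` are
still in the support and have weights `1/3 ± u`. At `|u| = 1/3` one outer weight vanishes, so closed
ranges of `u` are allowed. -/
theorem fiberSum_eq (f : ℝ → ℂ) {s x u : ℝ} (n : ℤ) (hu : x + 2 / 3 * n - s = u)
    (h : |u| ≤ 1 / 3) :
    fiberSum f s x = ((1 / 3 + u : ℝ) : ℂ) * f (x + 2 / 3 * ((n - 1 : ℤ) : ℝ)) +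
      ((1 - |u| : ℝ) : ℂ) * f (x + 2 / 3 * n) +
      ((1 / 3 - u : ℝ) : ℂ) * f (x + 2 / 3 * ((n + 1 : ℤ) : ℝ)) := by
  have hI : Finset.Icc (n - 1) (n + 1) = {n - 1, n, n + 1} := by
    ext m
    simp only [Finset.mem_Icc, Finset.mem_insert, Finset.mem_singleton]
    omega
  obtain ⟨h1, h2⟩ := abs_le.1 h
  have e1 : x + 2 / 3 * ((n - 1 : ℤ) : ℝ) - s = u - 2 / 3 := by
    rw [← hu]
    push_cast
    ring
  have e2 : x + 2 / 3 * ((n + 1 : ℤ) : ℝ) - s = u + 2 / 3 := by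
    rw [← hu]
    push_cast
    ring
  have a1 : |u - 2 / 3| = 2 / 3 - u := by rw [abs_of_nonpos (by linarith)]; ring
  have a2 : |u + 2 / 3| = u + 2 / 3 := abs_of_nonneg (by linarith)
  rw [fiberSum_eq_sum f n (by rwa [hu]), hI, Finset.sum_insert (by simp; omega),
    Finset.sum_insert (by simp), Finset.sum_singleton, e1, e2, hu,
    B₂_of_abs_le (u := u) (by linarith), B₂_of_abs_le (u := u - 2 / 3) (by rw [a1]; linarith),
    B₂_of_abs_le (u := u + 2 / 3) (by rw [a2]; linarith), a1, a2]
  push_cast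
  ring

theorem fiberSum_periodic (f : ℝ → ℂ) (s : ℝ) : Function.Periodic (fiberSum f s) (2 / 3) := by
  intro x
  rw [fiberSum, fiberSum,
    ← (Equiv.addRight (1 : ℤ)).tsum_eq fun n : ℤ => f (x + 2 / 3 * n) * B₂ (x + 2 / 3 * n - s)]
  congr 1
  ext n
  have : x + 2 / 3 + 2 / 3 * (n : ℝ) = x + 2 / 3 * ((n + 1 : ℤ) : ℝ) := by
    push_cast
    ring
  rw [this]
  rfl

theorem measurable_fiberSum {f : ℝ → ℂ} (hf : Measurable f) (s : ℝ) :
    Measurable (fiberSum f s) := by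
  refine measurable_of_tendsto_metrizable' Filter.atTop
    (f := fun (t : Finset ℤ) x => ∑ n ∈ t, f (x + 2 / 3 * n) * B₂ (x + 2 / 3 * n - s)) ?_
    (tendsto_pi_nhds.2 fun x => hasSum_fiberSum f s x)
  intro t
  refine Finset.measurable_fun_sum _ fun n _ => ?_
  exact (hf.comp (by fun_prop)).mul (continuous_B₂.measurable.comp (by fun_prop))

/-! ### Uniformly invertible linear systems -/

theorem norm_ofReal_mul_le {α A : ℝ} (h : |α| ≤ A) (z : ℂ) : ‖(α : ℂ) * z‖ ≤ A * ‖z‖ := by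
  rw [norm_mul, Complex.norm_real, Real.norm_eq_abs]
  exact mul_le_mul_of_nonneg_right h (norm_nonneg z)

theorem norm_le_div_of_ofReal_mul_eq {δ d B : ℝ} (hδ : 0 < δ) (hd : δ ≤ d) {z w : ℂ}
    (h : (d : ℂ) * z = w) (hw : ‖w‖ ≤ B) : ‖z‖ ≤ B / δ := by
  rw [← h, norm_mul, Complex.norm_real, Real.norm_eq_abs, abs_of_pos (hδ.trans_le hd)] at hw
  rw [le_div_iff₀' hδ]
  exact (mul_le_mul_of_nonneg_right hd (norm_nonneg z)).trans hw

/-- Stable inversion of the linear system for translation step `1/2`. -/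
theorem norm_le_of_half_system {t S : ℝ} (h0 : 0 ≤ t) (h1 : t ≤ 1)
    {c0 c1 c2 c3 c4 c5 r1 r2 r3 r4 r5 r6 : ℂ}
    (e1 : r1 = ((3 + t : ℝ) : ℂ) * c0 + ((5 - t : ℝ) : ℂ) * c1 + ((1 - t : ℝ) : ℂ) * c2)
    (e2 : r2 = (t : ℂ) * c0 + ((4 + t : ℝ) : ℂ) * c1 + ((4 - t : ℝ) : ℂ) * c2)
    (e3 : r3 = ((1 + t : ℝ) : ℂ) * c1 + ((5 + t : ℝ) : ℂ) * c2 + ((3 - t : ℝ) : ℂ) * c3)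
    (e4 : r4 = ((2 + t : ℝ) : ℂ) * c2 + ((6 - t : ℝ) : ℂ) * c3 + ((2 - t : ℝ) : ℂ) * c4)
    (e5 : r5 = ((3 + t : ℝ) : ℂ) * c3 + ((5 - t : ℝ) : ℂ) * c4 + ((1 - t : ℝ) : ℂ) * c5)
    (e6 : r6 = (t : ℂ) * c3 + ((4 + t : ℝ) : ℂ) * c4 + ((4 - t : ℝ) : ℂ) * c5)
    (hS : S = ‖r1‖ + ‖r2‖ + ‖r3‖ + ‖r4‖ + ‖r5‖ + ‖r6‖) :
    ‖c3‖ ≤ 8 * S ∧ ‖c4‖ ≤ 8 * S ∧ ‖c5‖ ≤ 8 * S := by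
  have n1 := norm_nonneg r1
  have n2 := norm_nonneg r2
  have n3 := norm_nonneg r3
  have n4 := norm_nonneg r4
  have n5 := norm_nonneg r5
  have n6 := norm_nonneg r6
  have t2 : 0 ≤ t ^ 2 := by positivity
  have t2' : t ^ 2 ≤ 1 := by nlinarith
  have t3 : 0 ≤ t ^ 3 := by positivity
  have t3' : t ^ 3 ≤ 1 := by nlinarith
  -- `p` and `q` are the pivots of an elimination from both ends towards `c3`, with `s1 = (6 + t +
  -- t²) c1 + 6 c2`, `s2 = p c2 + (3 - t)(6 + t + t²) c3` and `s3 = 6 c3 + q c4`.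
  obtain ⟨p, hp⟩ : ∃ p : ℝ, p = 24 + 5 * t + 6 * t ^ 2 + t ^ 3 := ⟨_, rfl⟩
  obtain ⟨q, hq⟩ : ∃ q : ℝ, q = 8 - 3 * t + t ^ 2 := ⟨_, rfl⟩
  have hp1 : 24 ≤ p := by linarith
  have hp2 : p ≤ 36 := by linarith
  have hq1 : 5 ≤ q := by linarith
  have hq2 : q ≤ 8 := by nlinarith
  obtain ⟨s1, hs1⟩ : ∃ s1 : ℂ, s1 = (((3 + t) / 2 : ℝ) : ℂ) * r2 - ((t / 2 : ℝ) : ℂ) * r1 :=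
    ⟨_, rfl⟩
  obtain ⟨s2, hs2⟩ : ∃ s2 : ℂ, s2 = ((6 + t + t ^ 2 : ℝ) : ℂ) * r3 - ((1 + t : ℝ) : ℂ) * s1 :=
    ⟨_, rfl⟩
  obtain ⟨s3, hs3⟩ : ∃ s3 : ℂ, s3 = (((4 - t) / 2 : ℝ) : ℂ) * r5 - (((1 - t) / 2 : ℝ) : ℂ) * r6 :=
    ⟨_, rfl⟩
  have b1 : ‖s1‖ ≤ 2 * ‖r2‖ + 1 * ‖r1‖ := by
    rw [hs1]
    refine (norm_sub_le _ _).trans (add_le_add ?_ ?_) <;>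
    · refine norm_ofReal_mul_le ?_ _
      rw [abs_of_nonneg (by linarith)]
      linarith
  have b2 : ‖s2‖ ≤ 8 * ‖r3‖ + 2 * ‖s1‖ := by
    rw [hs2]
    refine (norm_sub_le _ _).trans (add_le_add ?_ ?_) <;>
    · refine norm_ofReal_mul_le ?_ _
      rw [abs_of_nonneg (by linarith)]
      linarith
  have b3 : ‖s3‖ ≤ 2 * ‖r5‖ + 1 * ‖r6‖ := by
    rw [hs3]
    refine (norm_sub_le _ _).trans (add_le_add ?_ ?_) <;>
    · refine norm_ofReal_mul_le ?_ _
      rw [abs_of_nonneg (by linarith)]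
      linarith
  have hpq : 120 ≤ p * q := by nlinarith
  -- Only `r4` links the two halves; substituting `c2` and `c4` from `s2` and `s3` leaves `c3`
  -- alone.
  have k3 : (((6 - t) * (p * q) - (2 + t) * (3 - t) * (6 + t + t ^ 2) * q
      - 6 * (2 - t) * p : ℝ) : ℂ) * c3 =
      ((p * q : ℝ) : ℂ) * r4 - (((2 + t) * q : ℝ) : ℂ) * s2 - (((2 - t) * p : ℝ) : ℂ) * s3 := by
    rw [hs2, hs3, hs1, e1, e2, e3, e4, e5, e6, hp, hq]
    push_cast
    ring
  -- The three terms compare with `p q`: at least 5, at most 6.25/3 and at most 2 times it. What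
  -- remains exceeds `0.9 p q`, and `p q ≥ 120`.
  have hD : 100 ≤ (6 - t) * (p * q) - (2 + t) * (3 - t) * (6 + t + t ^ 2) * q
      - 6 * (2 - t) * p := by
    have i1 : 3 * (6 + t + t ^ 2) ≤ p := by linarith
    have i2 : 6 * (2 - t) ≤ 2 * q := by linarith
    have i3 : (2 + t) * (3 - t) ≤ 6.25 := by nlinarith [sq_nonneg (t - 1 / 2)]
    have i4 : (2 + t) * (3 - t) * (6 + t + t ^ 2) ≤ 6.25 * (p / 3) :=
      mul_le_mul i3 (by linarith) (by linarith) (by norm_num)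
    have i5 : (2 + t) * (3 - t) * (6 + t + t ^ 2) * q ≤ 6.25 * (p / 3) * q :=
      mul_le_mul_of_nonneg_right i4 (by linarith)
    have i6 : 6 * (2 - t) * p ≤ 2 * q * p := mul_le_mul_of_nonneg_right i2 (by linarith)
    have i7 : 5 * (p * q) ≤ (6 - t) * (p * q) :=
      mul_le_mul_of_nonneg_right (by linarith) (by linarith)
    nlinarith
  have g3 : ‖c3‖ ≤ 3 * S := by
    have hw : ‖((p * q : ℝ) : ℂ) * r4 - (((2 + t) * q : ℝ) : ℂ) * s2
        - (((2 - t) * p : ℝ) : ℂ) * s3‖ ≤ 288 * ‖r4‖ + 24 * ‖s2‖ + 72 * ‖s3‖ := by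
      refine (norm_sub_le _ _).trans (add_le_add ((norm_sub_le _ _).trans (add_le_add ?_ ?_)) ?_)
      · refine norm_ofReal_mul_le ?_ _
        rw [abs_of_nonneg (by positivity)]
        nlinarith
      · refine norm_ofReal_mul_le ?_ _
        rw [abs_of_nonneg (by positivity)]
        nlinarith
      · refine norm_ofReal_mul_le ?_ _
        rw [abs_of_nonneg (mul_nonneg (by linarith) (by linarith))]
        nlinarith
    have := norm_le_div_of_ofReal_mul_eq (by norm_num) hD k3 hw
    linarith
  have g4 : ‖c4‖ ≤ 4 * S := by
    have k4 : (q : ℂ) * c4 = s3 - ((6 : ℝ) : ℂ) * c3 := by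
      rw [hs3, e5, e6, hq]
      push_cast
      ring
    have := norm_le_div_of_ofReal_mul_eq (by norm_num) hq1 k4
      ((norm_sub_le _ _).trans (add_le_add_right (norm_ofReal_mul_le (A := 6) (by norm_num) c3) _))
    linarith
  have g5 : ‖c5‖ ≤ 8 * S := by
    have k5 : ((4 - t : ℝ) : ℂ) * c5 = r6 - (t : ℂ) * c3 - ((4 + t : ℝ) : ℂ) * c4 := by
      rw [e6]
      ring
    have hw : ‖r6 - (t : ℂ) * c3 - ((4 + t : ℝ) : ℂ) * c4‖ ≤ ‖r6‖ + 1 * ‖c3‖ + 5 * ‖c4‖ := by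
      refine (norm_sub_le _ _).trans (add_le_add ((norm_sub_le _ _).trans (add_le_add le_rfl ?_)) ?_)
      · exact norm_ofReal_mul_le (by rwa [abs_of_nonneg h0]) _
      · refine norm_ofReal_mul_le ?_ _
        rw [abs_of_nonneg (by linarith)]
        linarith
    have := norm_le_div_of_ofReal_mul_eq (δ := 3) (by norm_num) (by linarith) k5 hw
    linarith
  exact ⟨by linarith, by linarith, g5⟩

/-- Stable inversion of the linear system for translation step `3/8`. -/
theorem norm_le_of_three_eighths_system {x S : ℝ} (h0 : -1 ≤ x) (h1 : x ≤ 4)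
    {c0 c1 c2 c3 r1 r2 r3 r4 : ℂ}
    (e1 : r1 = ((15 - x : ℝ) : ℂ) * c0 + ((17 + x : ℝ) : ℂ) * c1 + ((1 + x : ℝ) : ℂ) * c2)
    (e2 : r2 = ((6 - x : ℝ) : ℂ) * c0 + ((22 - x : ℝ) : ℂ) * c1 + ((10 + x : ℝ) : ℂ) * c2)
    (e3 : r3 = ((13 - x : ℝ) : ℂ) * c1 + ((19 + x : ℝ) : ℂ) * c2 + ((3 + x : ℝ) : ℂ) * c3)
    (e4 : r4 = ((4 - x : ℝ) : ℂ) * c1 + ((20 - x : ℝ) : ℂ) * c2 + ((12 + x : ℝ) : ℂ) * c3)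
    (hS : S = ‖r1‖ + ‖r2‖ + ‖r3‖ + ‖r4‖) :
    ‖c0‖ ≤ 5 * S ∧ ‖c2‖ ≤ 5 * S := by
  have n1 := norm_nonneg r1
  have n2 := norm_nonneg r2
  have n3 := norm_nonneg r3
  have n4 := norm_nonneg r4
  -- Eliminating `c0` from the first pair of equations and `c3` from the second leaves `s1 = p c1 +
  -- 144 c2` and `s2 = 144 c1 + q c2`. On `[-1, 4]` both `p` and `q` are at least 156, so the
  -- determinant is at least `156² - 144² = 3600`.
  obtain ⟨p, hp⟩ : ∃ p : ℝ, p = 228 - 26 * x + 2 * x ^ 2 := ⟨_, rfl⟩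
  obtain ⟨q, hq⟩ : ∃ q : ℝ, q = 168 + 14 * x + 2 * x ^ 2 := ⟨_, rfl⟩
  have hp1 : 156 ≤ p := by nlinarith
  have hp2 : p ≤ 256 := by nlinarith
  have hq1 : 156 ≤ q := by nlinarith
  have hq2 : q ≤ 256 := by nlinarith
  obtain ⟨s1, hs1⟩ : ∃ s : ℂ, s = ((15 - x : ℝ) : ℂ) * r2 - ((6 - x : ℝ) : ℂ) * r1 := ⟨_, rfl⟩
  obtain ⟨s2, hs2⟩ : ∃ s : ℂ, s = ((12 + x : ℝ) : ℂ) * r3 - ((3 + x : ℝ) : ℂ) * r4 := ⟨_, rfl⟩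
  have b1 : ‖s1‖ ≤ 16 * ‖r2‖ + 16 * ‖r1‖ := by
    rw [hs1]
    refine (norm_sub_le _ _).trans (add_le_add ?_ ?_) <;>
    · refine norm_ofReal_mul_le ?_ _
      rw [abs_of_nonneg (by linarith)]
      linarith
  have b2 : ‖s2‖ ≤ 16 * ‖r3‖ + 16 * ‖r4‖ := by
    rw [hs2]
    refine (norm_sub_le _ _).trans (add_le_add ?_ ?_) <;>
    · refine norm_ofReal_mul_le ?_ _
      rw [abs_of_nonneg (by linarith)]
      linarith
  have hD : 3600 ≤ p * q - 144 * 144 := by nlinarith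
  have k1 : ((p * q - 144 * 144 : ℝ) : ℂ) * c1 = (q : ℂ) * s1 - ((144 : ℝ) : ℂ) * s2 := by
    rw [hs1, hs2, e1, e2, e3, e4, hp, hq]
    push_cast
    ring
  have k2 : ((p * q - 144 * 144 : ℝ) : ℂ) * c2 = (p : ℂ) * s2 - ((144 : ℝ) : ℂ) * s1 := by
    rw [hs1, hs2, e1, e2, e3, e4, hp, hq]
    push_cast
    ring
  have g1 : ‖c1‖ ≤ 2 * S := by
    have := norm_le_div_of_ofReal_mul_eq (by norm_num) hD k1 ((norm_sub_le _ _).trans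
      (add_le_add (norm_ofReal_mul_le (A := 256) (by rwa [abs_of_nonneg (by linarith)]) s1)
        (norm_ofReal_mul_le (A := 144) (by norm_num) s2)))
    linarith
  have g2 : ‖c2‖ ≤ 2 * S := by
    have := norm_le_div_of_ofReal_mul_eq (by norm_num) hD k2 ((norm_sub_le _ _).trans
      (add_le_add (norm_ofReal_mul_le (A := 256) (by rwa [abs_of_nonneg (by linarith)]) s2)
        (norm_ofReal_mul_le (A := 144) (by norm_num) s1)))
    linarith
  refine ⟨?_, by linarith⟩
  have k0 : ((15 - x : ℝ) : ℂ) * c0 = r1 - ((17 + x : ℝ) : ℂ) * c1 - ((1 + x : ℝ) : ℂ) * c2 := by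
    rw [e1]
    ring
  have hw : ‖r1 - ((17 + x : ℝ) : ℂ) * c1 - ((1 + x : ℝ) : ℂ) * c2‖ ≤
      ‖r1‖ + 21 * ‖c1‖ + 5 * ‖c2‖ := by
    refine (norm_sub_le _ _).trans (add_le_add ((norm_sub_le _ _).trans (add_le_add le_rfl ?_)) ?_) <;>
    · refine norm_ofReal_mul_le ?_ _
      rw [abs_of_nonneg (by linarith)]
      linarith
  have := norm_le_div_of_ofReal_mul_eq (δ := 11) (by norm_num) (by linarith) k0 hw
  linarith

/-! ### Pointwise recovery for the steps 1/2 and 3/8 -/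

/-- `f x` is controlled by boundedly many periodizations with windows centred near `x`. -/
def LocallyRecoverable (a : ℝ) : Prop :=
  ∃ (C : ℝ) (N : ℕ), 0 ≤ C ∧ ∀ (f : ℝ → ℂ) (x : ℝ), ∃ m : ℤ, |x - m * a| ≤ N ∧
    ‖f x‖ ≤ C * ∑ i ∈ Finset.range N, ‖fiberSum f (((m + i : ℤ) : ℝ) * a) x‖

/-- `fiberSum_eq` after rescaling the line by a factor `L`. -/
theorem mul_fiberSum_eq (f : ℝ → ℂ) {s x u L : ℝ} {n n₁ n₂ : ℤ} (hL : 0 < L)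
    (hu : x + 2 / 3 * n - s = u / L) (h : |u| ≤ L / 3) (h₁ : n₁ = n - 1) (h₂ : n₂ = n + 1)
    {α β γ : ℝ} (hα : α = L / 3 + u) (hβ : β = L - |u|) (hγ : γ = L / 3 - u) :
    (L : ℂ) * fiberSum f s x = (α : ℂ) * f (x + 2 / 3 * n₁) + (β : ℂ) * f (x + 2 / 3 * n) +
      (γ : ℂ) * f (x + 2 / 3 * n₂) := by
  have hL' : (L : ℂ) ≠ 0 := by exact_mod_cast hL.ne'
  have habs : |u / L| = |u| / L := by rw [abs_div, abs_of_pos hL]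
  rw [fiberSum_eq f n hu (by rw [habs, div_le_iff₀ hL]; linarith), habs, h₁, h₂, hα, hβ, hγ]
  push_cast
  field_simp

theorem locallyRecoverable_half : LocallyRecoverable (1 / 2) := by
  -- Six windows; 48 is the constant 8 of the linear system times the scaling factor 6.
  refine ⟨48, 6, by norm_num, fun f x => ?_⟩
  obtain ⟨t, ht⟩ : ∃ t : ℝ, t = Int.fract (6 * x) := ⟨_, rfl⟩
  have t0 : 0 ≤ t := ht ▸ Int.fract_nonneg _
  have t1 : t ≤ 1 := ht ▸ (Int.fract_lt_one _).le
  -- In units of 1/6 windows are 3 apart and samples 4 apart, so moving both indices back by `i`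
  -- lowers the offset by `i`. This cancels the residue of `⌊6 * x⌋` mod 3 and makes `f x` the
  -- unknown `c3`, `c4` or `c5`.
  obtain ⟨m, i, hi0, hi2, hmi⟩ : ∃ m i : ℤ, 0 ≤ i ∧ i ≤ 2 ∧ ⌊6 * x⌋ = 3 * m + i :=
    ⟨⌊6 * x⌋ / 3, ⌊6 * x⌋ % 3, by omega, by omega, by omega⟩
  have hx : x = (t + (3 * m + i)) / 6 := by
    have h := Int.fract_add_floor (6 * x)
    rw [hmi, ← ht] at h
    push_cast at h
    linarith
  have hi0' : (0 : ℝ) ≤ i := by exact_mod_cast hi0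
  have hi2' : (i : ℝ) ≤ 2 := by exact_mod_cast hi2
  refine ⟨m - 3 - i, ?_, ?_⟩
  · push_cast
    rw [abs_le, hx]
    constructor <;> linarith
  have key := norm_le_of_half_system t0 t1
    (mul_fiberSum_eq f (s := ((m - 3 - i + 0 : ℤ) : ℝ) * (1 / 2)) (x := x) (u := 1 + t) (L := 6)
      (n := 1 - 3 - i) (n₁ := 0 - 3 - i) (n₂ := 2 - 3 - i) (by norm_num)
      (by rw [hx]; push_cast; ring) (by rw [abs_of_nonneg (by linarith)]; linarith)
      (by ring) (by ring) (by ring) (by rw [abs_of_nonneg (by linarith)]; ring) (by ring))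
    (mul_fiberSum_eq f (s := ((m - 3 - i + 1 : ℤ) : ℝ) * (1 / 2)) (x := x) (u := t - 2) (L := 6)
      (n := 1 - 3 - i) (n₁ := 0 - 3 - i) (n₂ := 2 - 3 - i) (by norm_num)
      (by rw [hx]; push_cast; ring) (by rw [abs_of_nonpos (by linarith)]; linarith)
      (by ring) (by ring) (by ring) (by rw [abs_of_nonpos (by linarith)]; ring) (by ring))
    (mul_fiberSum_eq f (s := ((m - 3 - i + 2 : ℤ) : ℝ) * (1 / 2)) (x := x) (u := t - 1) (L := 6)
      (n := 2 - 3 - i) (n₁ := 1 - 3 - i) (n₂ := 3 - 3 - i) (by norm_num)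
      (by rw [hx]; push_cast; ring) (by rw [abs_of_nonpos (by linarith)]; linarith)
      (by ring) (by ring) (by ring) (by rw [abs_of_nonpos (by linarith)]; ring) (by ring))
    (mul_fiberSum_eq f (s := ((m - 3 - i + 3 : ℤ) : ℝ) * (1 / 2)) (x := x) (u := t) (L := 6)
      (n := 3 - 3 - i) (n₁ := 2 - 3 - i) (n₂ := 4 - 3 - i) (by norm_num)
      (by rw [hx]; push_cast; ring) (by rw [abs_of_nonneg (by linarith)]; linarith)
      (by ring) (by ring) (by ring) (by rw [abs_of_nonneg (by linarith)]) (by ring))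
    (mul_fiberSum_eq f (s := ((m - 3 - i + 4 : ℤ) : ℝ) * (1 / 2)) (x := x) (u := 1 + t) (L := 6)
      (n := 4 - 3 - i) (n₁ := 3 - 3 - i) (n₂ := 5 - 3 - i) (by norm_num)
      (by rw [hx]; push_cast; ring) (by rw [abs_of_nonneg (by linarith)]; linarith)
      (by ring) (by ring) (by ring) (by rw [abs_of_nonneg (by linarith)]; ring) (by ring))
    (mul_fiberSum_eq f (s := ((m - 3 - i + 5 : ℤ) : ℝ) * (1 / 2)) (x := x) (u := t - 2) (L := 6)
      (n := 4 - 3 - i) (n₁ := 3 - 3 - i) (n₂ := 5 - 3 - i) (by norm_num)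
      (by rw [hx]; push_cast; ring) (by rw [abs_of_nonpos (by linarith)]; linarith)
      (by ring) (by ring) (by ring) (by rw [abs_of_nonpos (by linarith)]; ring) (by ring))
    rfl
  simp only [norm_mul, Complex.norm_real, Real.norm_eq_abs, abs_of_pos (by norm_num : (0 : ℝ) < 6)]
    at key
  simp only [Finset.sum_range_succ, Finset.sum_range_zero, Nat.cast_ofNat, Nat.cast_zero,
    Nat.cast_one, zero_add]
  obtain ⟨k3, k4, k5⟩ := key
  obtain rfl | rfl | rfl : i = 0 ∨ i = 1 ∨ i = 2 := by omega
  · have hz : x + 2 / 3 * ((3 - 3 - 0 : ℤ) : ℝ) = x := by norm_num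
    rw [hz] at k3
    linarith
  · have hz : x + 2 / 3 * ((4 - 3 - 1 : ℤ) : ℝ) = x := by norm_num
    rw [hz] at k4
    linarith
  · have hz : x + 2 / 3 * ((5 - 3 - 2 : ℤ) : ℝ) = x := by norm_num
    rw [hz] at k5
    linarith

/-- The values at `24 x = y + 36 - 16 j + 9 m`, `y ∈ [-1, 4]`, for `j = 0, 2`. -/
theorem norm_le_of_three_eighths (f : ℝ → ℂ) {x y : ℝ} {m : ℤ} {l : ℤ} (h0 : -1 ≤ y) (h1 : y ≤ 4)
    (hx : x = (y + 36 - 16 * l + 9 * m) / 24) :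
    ‖f (x + 2 / 3 * (l : ℝ))‖ ≤ 120 *
        ∑ i ∈ Finset.range 4, ‖fiberSum f (((m + i : ℤ) : ℝ) * (3 / 8)) x‖ ∧
      ‖f (x + 2 / 3 * ((l - 2 : ℤ) : ℝ))‖ ≤ 120 *
        ∑ i ∈ Finset.range 4, ‖fiberSum f (((m + i : ℤ) : ℝ) * (3 / 8)) x‖ := by
  -- In units of 1/24 windows are 9 apart and samples 16 apart. The offsets `y - 7`, `y + 2`, `y -
  -- 5`, `y + 4` must have modulus at most 8; the first and last force exactly `-1 ≤ y ≤ 4`.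
  have e1 := mul_fiberSum_eq f (s := ((m + 3 : ℤ) : ℝ) * (3 / 8)) (x := x) (u := y - 7) (L := 24)
      (n := l - 1) (n₁ := l - 2) (n₂ := l) (α := 1 + y) (β := 17 + y) (γ := 15 - y) (by norm_num)
      (by rw [hx]; push_cast; ring) (by rw [abs_of_nonpos (by linarith)]; linarith)
      (by ring) (by ring) (by ring) (by rw [abs_of_nonpos (by linarith)]; ring) (by ring)
  have e2 := mul_fiberSum_eq f (s := ((m + 2 : ℤ) : ℝ) * (3 / 8)) (x := x) (u := y + 2) (L := 24)
      (n := l - 1) (n₁ := l - 2) (n₂ := l) (α := 10 + y) (β := 22 - y) (γ := 6 - y) (by norm_num)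
      (by rw [hx]; push_cast; ring) (by rw [abs_of_nonneg (by linarith)]; linarith)
      (by ring) (by ring) (by ring) (by rw [abs_of_nonneg (by linarith)]; ring) (by ring)
  have e3 := mul_fiberSum_eq f (s := ((m + 1 : ℤ) : ℝ) * (3 / 8)) (x := x) (u := y - 5) (L := 24)
      (n := l - 2) (n₁ := l - 3) (n₂ := l - 1) (α := 3 + y) (β := 19 + y) (γ := 13 - y)
      (by norm_num)
      (by rw [hx]; push_cast; ring) (by rw [abs_of_nonpos (by linarith)]; linarith)
      (by ring) (by ring) (by ring) (by rw [abs_of_nonpos (by linarith)]; ring) (by ring)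
  have e4 := mul_fiberSum_eq f (s := ((m + 0 : ℤ) : ℝ) * (3 / 8)) (x := x) (u := y + 4) (L := 24)
      (n := l - 2) (n₁ := l - 3) (n₂ := l - 1) (α := 12 + y) (β := 20 - y) (γ := 4 - y)
      (by norm_num)
      (by rw [hx]; push_cast; ring) (by rw [abs_of_nonneg (by linarith)]; linarith)
      (by ring) (by ring) (by ring) (by rw [abs_of_nonneg (by linarith)]; ring) (by ring)
  have key := norm_le_of_three_eighths_system
    (c0 := f (x + 2 / 3 * l)) (c1 := f (x + 2 / 3 * ((l - 1 : ℤ) : ℝ)))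
    (c2 := f (x + 2 / 3 * ((l - 2 : ℤ) : ℝ))) (c3 := f (x + 2 / 3 * ((l - 3 : ℤ) : ℝ))) h0 h1 (e1.trans (by ring)) 
    (e2.trans (by ring)) (e3.trans (by ring)) (e4.trans (by ring)) rfl
  simp only [norm_mul, Complex.norm_real, Real.norm_eq_abs,
    abs_of_pos (by norm_num : (0 : ℝ) < 24)] at key
  simp only [Finset.sum_range_succ, Finset.sum_range_zero, Nat.cast_ofNat, Nat.cast_zero,
    Nat.cast_one, zero_add]
  exact ⟨by linarith [key.1], by linarith [key.2]⟩

theorem locallyRecoverable_three_eighths : LocallyRecoverable (3 / 8) := by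
  refine ⟨120, 4, by norm_num, fun f x => ?_⟩
  obtain ⟨m, hm⟩ : ∃ m : ℤ, m = ⌊(24 * x + 1) / 9⌋ := ⟨_, rfl⟩
  have l1 : (m : ℝ) ≤ (24 * x + 1) / 9 := hm ▸ Int.floor_le _
  have l2 : (24 * x + 1) / 9 < (m : ℝ) + 1 := hm ▸ Int.lt_floor_add_one _
  -- Modulo the window step 9, the unknown `c0` sits at `y` and `c2` at `y + 4`; together `[-1, 4]`
  -- and `[3, 8]` cover a full period starting at -1.
  rcases le_total (24 * x - 9 * m) 4 with h | h
  · refine ⟨m - 4, ?_, ?_⟩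
    · push_cast
      rw [abs_le]
      constructor <;> linarith
    · have := (norm_le_of_three_eighths f (x := x) (y := 24 * x - 9 * m) (m := m - 4) (l := 0)
        (by linarith) h (by push_cast; ring)).1
      rwa [Int.cast_zero, mul_zero, add_zero] at this
  · refine ⟨m, ?_, ?_⟩
    · push_cast
      rw [abs_le]
      constructor <;> linarith
    · have := (norm_le_of_three_eighths f (x := x) (y := 24 * x - 9 * m - 4) (m := m) (l := 2)
        (by linarith) (by linarith) (by push_cast; ring)).2
      rwa [sub_self, Int.cast_zero, mul_zero, add_zero] at this

/-! ### From pointwise recovery to the lower bound -/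

theorem setLIntegral_Ioc_comp_add (h : ℝ → ENNReal) (T c d : ℝ) :
    ∫⁻ x in Set.Ioc c d, h (x + T) = ∫⁻ x in Set.Ioc (c + T) (d + T), h x := by
  have := (measurePreserving_add_right volume T).setLIntegral_comp_preimage_emb
    (measurableEmbedding_addRight T) h (Set.Ioc (c + T) (d + T))
  rw [← this, Set.preimage_add_const_Ioc, add_sub_cancel_right, add_sub_cancel_right]

theorem setLIntegral_Ioc_add_period {h : ℝ → ENNReal} {T : ℝ} (hT : Function.Periodic h T)
    (c d : ℝ) : ∫⁻ x in Set.Ioc (c + T) (d + T), h x = ∫⁻ x in Set.Ioc c d, h x := by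
  rw [← setLIntegral_Ioc_comp_add]
  simp only [hT _]

theorem setLIntegral_Ioc_nat_mul_period {h : ℝ → ENNReal} {T : ℝ} (hT : Function.Periodic h T)
    (hT0 : 0 ≤ T) (c : ℝ) (n : ℕ) :
    ∫⁻ x in Set.Ioc c (c + n * T), h x = n * ∫⁻ x in Set.Ioc c (c + T), h x := by
  induction n with
  | zero => simp
  | succ n ih =>
    have hn : 0 ≤ n * T := by positivity
    have hU : Set.Ioc c (c + (n + 1 : ℕ) * T) =
        Set.Ioc c (c + n * T) ∪ Set.Ioc (c + n * T) (c + T + n * T) := by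
      rw [Set.Ioc_union_Ioc_eq_Ioc (by linarith) (by linarith)]
      congr 1
      push_cast
      ring
    rw [hU, lintegral_union measurableSet_Ioc
      (Set.disjoint_left.2 fun x hx hx' => absurd hx.2 (not_le.2 hx'.1)), ih,
      setLIntegral_Ioc_add_period (hT.nat_mul n)]
    push_cast
    ring

/-- `∫ |F|²` over the period centred at `s`, where `F` is the periodization `fiberSum f s`. -/
def fiberEnergy (f : ℝ → ℂ) (s : ℝ) : ENNReal :=
  ∫⁻ x in Set.Ioc (s - 1 / 3) (s + 1 / 3), ‖fiberSum f s x‖ₑ ^ 2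

/-- An odd number of periods makes the enlarged interval symmetric about `s`, so it contains every
`x` close enough to `s`. -/
theorem setLIntegral_fiberSum (f : ℝ → ℂ) (s : ℝ) (L : ℕ) :
    ∫⁻ x in Set.Ioc (s - (1 / 3 + 2 / 3 * L)) (s + (1 / 3 + 2 / 3 * L)), ‖fiberSum f s x‖ₑ ^ 2 =
      (2 * L + 1 : ℕ) * fiberEnergy f s := by
  have hp : Function.Periodic (fun x => ‖fiberSum f s x‖ₑ ^ 2) (2 / 3) := fun x => by
    simp only [fiberSum_periodic f s x]
  have h1 := setLIntegral_Ioc_nat_mul_period hp (by norm_num) (s - (1 / 3 + 2 / 3 * L)) (2 * L + 1)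
  have h2 := setLIntegral_Ioc_add_period (hp.nat_mul L) (s - (1 / 3 + 2 / 3 * L))
    (s - (1 / 3 + 2 / 3 * L) + 2 / 3)
  have e1 : s - (1 / 3 + 2 / 3 * (L : ℝ)) + (2 * L + 1 : ℕ) * (2 / 3) =
      s + (1 / 3 + 2 / 3 * L) := by
    push_cast
    ring
  have e2 : s - (1 / 3 + 2 / 3 * (L : ℝ)) + L * (2 / 3) = s - 1 / 3 := by ring
  have e3 : s - (1 / 3 + 2 / 3 * (L : ℝ)) + 2 / 3 + L * (2 / 3) = s + 1 / 3 := by ring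
  rw [e1] at h1
  rw [e2, e3] at h2
  rw [h1, ← h2, fiberEnergy]

theorem ofReal_norm_sq (z : ℂ) : ENNReal.ofReal (‖z‖ ^ 2) = ‖z‖ₑ ^ 2 := by
  rw [ENNReal.ofReal_pow (norm_nonneg z), ofReal_norm]

theorem LocallyRecoverable.lintegral_le {a : ℝ} (ha : LocallyRecoverable a) :
    ∃ C : ENNReal, C ≠ ⊤ ∧ ∀ f : ℝ → ℂ, Measurable f →
      ∫⁻ x, ‖f x‖ₑ ^ 2 ≤ C * ∑' k : ℤ, fiberEnergy f (k * a) := by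
  obtain ⟨C, N, hC, h⟩ := ha
  -- `L` makes `R` exceed the distance from `x` to each of the `N` window centres used at `x`. The
  -- indicators below then never discard a needed term.
  obtain ⟨L, hL⟩ := exists_nat_ge ((N + N * |a|) * (3 / 2))
  obtain ⟨R, hR⟩ : ∃ R : ℝ, R = 1 / 3 + 2 / 3 * L := ⟨_, rfl⟩
  have hR' : N + N * |a| < R := by linarith
  refine ⟨ENNReal.ofReal (C ^ 2 * N) * (2 * L + 1 : ℕ),
    ENNReal.mul_ne_top ENNReal.ofReal_ne_top (ENNReal.natCast_ne_top _), fun f hf => ?_⟩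
  have hmeas : ∀ s : ℝ, Measurable fun x => ‖fiberSum f s x‖ₑ ^ 2 := fun s =>
    (measurable_fiberSum hf s).enorm.pow_const 2
  have hpt : ∀ x, ‖f x‖ₑ ^ 2 ≤ ENNReal.ofReal (C ^ 2 * N) *
      ∑' k : ℤ, (Set.Ioc (k * a - R) (k * a + R)).indicator
        (fun x => ‖fiberSum f (k * a) x‖ₑ ^ 2) x := by
    intro x
    obtain ⟨m, hm, hfx⟩ := h f x
    have h1 : ‖f x‖ ^ 2 ≤ C ^ 2 * N *
        ∑ i ∈ Finset.range N, ‖fiberSum f (((m + i : ℤ) : ℝ) * a) x‖ ^ 2 := by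
      have hcs := sq_sum_le_card_mul_sum_sq (s := Finset.range N)
        (f := fun i : ℕ => ‖fiberSum f (((m + i : ℤ) : ℝ) * a) x‖)
      rw [Finset.card_range] at hcs
      calc ‖f x‖ ^ 2 ≤ (C * ∑ i ∈ Finset.range N, ‖fiberSum f (((m + i : ℤ) : ℝ) * a) x‖) ^ 2 :=
            pow_le_pow_left₀ (norm_nonneg _) hfx 2
        _ ≤ C ^ 2 * (N * ∑ i ∈ Finset.range N, ‖fiberSum f (((m + i : ℤ) : ℝ) * a) x‖ ^ 2) := by
            rw [mul_pow]
            exact mul_le_mul_of_nonneg_left hcs (sq_nonneg C)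
        _ = _ := by ring
    rw [← ofReal_norm_sq]
    refine (ENNReal.ofReal_le_ofReal h1).trans ?_
    rw [ENNReal.ofReal_mul (by positivity),
      ENNReal.ofReal_sum_of_nonneg fun i _ => by positivity]
    gcongr
    simp only [ofReal_norm_sq]
    have hinj : Function.Injective fun i : ℕ => m + (i : ℤ) := fun i j hij => by simpa using hij
    refine le_trans (le_of_eq ?_) (ENNReal.sum_le_tsum
      ((Finset.range N).image fun i : ℕ => m + (i : ℤ)))
    rw [Finset.sum_image hinj.injOn]
    refine Finset.sum_congr rfl fun i hi => ?_
    have hiN : (i : ℝ) ≤ N := by exact_mod_cast (Finset.mem_range.1 hi).le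
    have hia : |(i : ℝ) * a| ≤ N * |a| := by
      rw [abs_mul, abs_of_nonneg (Nat.cast_nonneg i)]
      exact mul_le_mul_of_nonneg_right hiN (abs_nonneg a)
    obtain ⟨i1, i2⟩ := abs_le.1 hia
    obtain ⟨m1, m2⟩ := abs_le.1 hm
    rw [Set.indicator_of_mem]
    rw [Set.mem_Ioc]
    push_cast
    constructor <;> linarith
  calc ∫⁻ x, ‖f x‖ₑ ^ 2 ≤ ∫⁻ x, ENNReal.ofReal (C ^ 2 * N) *
        ∑' k : ℤ, (Set.Ioc (k * a - R) (k * a + R)).indicator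
          (fun x => ‖fiberSum f (k * a) x‖ₑ ^ 2) x := lintegral_mono hpt
    _ = ENNReal.ofReal (C ^ 2 * N) * ∑' k : ℤ, ∫⁻ x in Set.Ioc (k * a - R) (k * a + R),
          ‖fiberSum f (k * a) x‖ₑ ^ 2 := by
        rw [lintegral_const_mul' _ _ ENNReal.ofReal_ne_top,
          lintegral_tsum fun k => ((hmeas _).indicator measurableSet_Ioc).aemeasurable]
        simp only [lintegral_indicator measurableSet_Ioc]
    _ = _ := by
        simp only [hR, setLIntegral_fiberSum, ENNReal.tsum_mul_left]
        ring

/-! ### The upper bound -/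

theorem fiberSum_eq_add (f : ℝ → ℂ) {s x : ℝ} (h : |x - s| ≤ 1 / 3) :
    fiberSum f s x = f (x - 2 / 3) * B₂ (x - 2 / 3 - s) + f x * B₂ (x - s) +
      f (x + 2 / 3) * B₂ (x + 2 / 3 - s) := by
  have hI : Finset.Icc (0 - 1 : ℤ) (0 + 1) = {-1, 0, 1} := by decide
  rw [fiberSum_eq_sum f 0 (by simpa using h), hI, Finset.sum_insert (by decide),
    Finset.sum_insert (by decide), Finset.sum_singleton]
  simp only [Int.cast_neg, Int.cast_one, Int.cast_zero, mul_zero, add_zero, mul_one, mul_neg,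
    ← sub_eq_add_neg]
  ring

theorem enorm_add_add_sq_le (u v w : ℂ) :
    ‖u + v + w‖ₑ ^ 2 ≤ 3 * (‖u‖ₑ ^ 2 + ‖v‖ₑ ^ 2 + ‖w‖ₑ ^ 2) := by
  simp only [← ofReal_norm_sq]
  rw [← ENNReal.ofReal_add (by positivity) (by positivity),
    ← ENNReal.ofReal_add (by positivity) (by positivity),
    show (3 : ENNReal) = ENNReal.ofReal 3 by simp, ← ENNReal.ofReal_mul (by norm_num)]
  refine ENNReal.ofReal_le_ofReal ?_
  have := pow_le_pow_left₀ (norm_nonneg _) (norm_add₃_le (a := u) (b := v) (c := w)) 2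
  nlinarith [sq_nonneg (‖u‖ - ‖v‖), sq_nonneg (‖u‖ - ‖w‖), sq_nonneg (‖v‖ - ‖w‖)]

theorem enorm_mul_B₂_sq_le (z : ℂ) (u : ℝ) : ‖z * B₂ u‖ₑ ^ 2 ≤ ‖z‖ₑ ^ 2 := by
  rw [← ofReal_norm_sq, ← ofReal_norm_sq, norm_mul]
  refine ENNReal.ofReal_le_ofReal (pow_le_pow_left₀ (by positivity) ?_ 2)
  exact mul_le_of_le_one_right (norm_nonneg z) (norm_B₂_le_one u)

/-- One factor 3 in 9 comes from squaring a sum of three terms, the other from bounding three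
translated integrals by the same one. -/
theorem fiberEnergy_le {f : ℝ → ℂ} (hf : Measurable f) (s : ℝ) :
    fiberEnergy f s ≤ 9 * ∫⁻ x in Set.Ioc (s - 1) (s + 1), ‖f x‖ₑ ^ 2 := by
  have hshift : ∀ T : ℝ, |T| ≤ 2 / 3 → ∫⁻ x in Set.Ioc (s - 1 / 3) (s + 1 / 3), ‖f (x + T)‖ₑ ^ 2 ≤
      ∫⁻ x in Set.Ioc (s - 1) (s + 1), ‖f x‖ₑ ^ 2 := by
    intro T hT
    obtain ⟨h1, h2⟩ := abs_le.1 hT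
    rw [setLIntegral_Ioc_comp_add (fun x => ‖f x‖ₑ ^ 2)]
    exact lintegral_mono_set (Set.Ioc_subset_Ioc (by linarith) (by linarith))
  have hm : ∀ T : ℝ, Measurable fun x => ‖f (x + T)‖ₑ ^ 2 := fun T =>
    (hf.comp (measurable_add_const T)).enorm.pow_const 2
  calc fiberEnergy f s
      ≤ ∫⁻ x in Set.Ioc (s - 1 / 3) (s + 1 / 3),
          3 * (‖f (x + -(2 / 3))‖ₑ ^ 2 + ‖f (x + 0)‖ₑ ^ 2 + ‖f (x + 2 / 3)‖ₑ ^ 2) := by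
        refine setLIntegral_mono' measurableSet_Ioc fun x hx => ?_
        rw [fiberSum_eq_add f (abs_le.2 ⟨by linarith [hx.1], by linarith [hx.2]⟩)]
        refine (enorm_add_add_sq_le _ _ _).trans ?_
        rw [add_zero, ← sub_eq_add_neg]
        exact mul_le_mul_right (add_le_add (add_le_add (enorm_mul_B₂_sq_le _ _)
          (enorm_mul_B₂_sq_le _ _)) (enorm_mul_B₂_sq_le _ _)) _
    _ ≤ 3 * (((∫⁻ x in Set.Ioc (s - 1) (s + 1), ‖f x‖ₑ ^ 2) +
          ∫⁻ x in Set.Ioc (s - 1) (s + 1), ‖f x‖ₑ ^ 2) +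
          ∫⁻ x in Set.Ioc (s - 1) (s + 1), ‖f x‖ₑ ^ 2) := by
        rw [lintegral_const_mul' _ _ (by simp), lintegral_add_right _ (hm _),
          lintegral_add_right _ (hm _)]
        exact mul_le_mul_right (add_le_add (add_le_add
          (hshift _ (by rw [abs_neg, abs_of_pos]; norm_num)) (hshift _ (by norm_num)))
          (hshift _ (by rw [abs_of_pos]; norm_num))) _
    _ = _ := by ring

theorem tsum_fiberEnergy_le {a : ℝ} (ha : 0 < a) :
    ∃ C : ENNReal, C ≠ ⊤ ∧ ∀ f : ℝ → ℂ, Measurable f →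
      ∑' k : ℤ, fiberEnergy f (k * a) ≤ C * ∫⁻ x, ‖f x‖ₑ ^ 2 := by
  -- `K` bounds the number of `k` with `x` within distance 1 of `k * a`.
  obtain ⟨K, hK⟩ := exists_nat_ge (2 / a + 1)
  refine ⟨9 * K, ENNReal.mul_ne_top (by simp) (ENNReal.natCast_ne_top _), fun f hf => ?_⟩
  have hm : Measurable fun x => ‖f x‖ₑ ^ 2 := hf.enorm.pow_const 2
  have hpt : ∀ x, ∑' k : ℤ, (Set.Ioc (k * a - 1) (k * a + 1)).indicator (fun x => ‖f x‖ₑ ^ 2) x ≤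
      K * ‖f x‖ₑ ^ 2 := by
    intro x
    rw [tsum_eq_sum (s := Finset.Icc ⌈(x - 1) / a⌉ ⌊(x + 1) / a⌋)]
    · refine (Finset.sum_le_card_nsmul _ _ (‖f x‖ₑ ^ 2) fun k _ =>
        Set.indicator_le_self' (fun _ _ => zero_le) x).trans ?_
      rw [nsmul_eq_mul]
      gcongr
      rw [Int.card_Icc, Int.toNat_le]
      have h1 := Int.floor_le ((x + 1) / a)
      have h2 := Int.le_ceil ((x - 1) / a)
      have h3 : (x + 1) / a - (x - 1) / a = 2 / a := by ring
      have h4 : ((⌊(x + 1) / a⌋ + 1 - ⌈(x - 1) / a⌉ : ℤ) : ℝ) ≤ ((K : ℤ) : ℝ) := by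
        push_cast
        linarith
      exact_mod_cast h4
    · intro k hk
      refine Set.indicator_of_notMem (fun hx => hk ?_) _
      rw [Finset.mem_Icc, Int.ceil_le, Int.le_floor, div_le_iff₀ ha, le_div_iff₀ ha]
      exact ⟨by linarith [hx.2], by linarith [hx.1]⟩
  calc ∑' k : ℤ, fiberEnergy f (k * a)
      ≤ ∑' k : ℤ, 9 * ∫⁻ x, (Set.Ioc (k * a - 1) (k * a + 1)).indicator (fun x => ‖f x‖ₑ ^ 2) x :=
        ENNReal.tsum_le_tsum fun k => by
          rw [lintegral_indicator measurableSet_Ioc]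
          exact fiberEnergy_le hf _
    _ = 9 * ∫⁻ x, ∑' k : ℤ, (Set.Ioc (k * a - 1) (k * a + 1)).indicator
          (fun x => ‖f x‖ₑ ^ 2) x := by
        rw [ENNReal.tsum_mul_left,
          lintegral_tsum fun k => (hm.indicator measurableSet_Ioc).aemeasurable]
    _ ≤ 9 * ∫⁻ x, K * ‖f x‖ₑ ^ 2 := by
        gcongr
        exact hpt _
    _ = _ := by
        rw [lintegral_const_mul _ hm, mul_assoc]

/-! ### Gabor coefficients as Fourier coefficients -/

theorem third_interval_lt (s : ℝ) : s - 1 / 3 < s + 1 / 3 := by linarith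

theorem third_interval_length (s : ℝ) : s + 1 / 3 - (s - 1 / 3) = 2 / 3 := by ring

theorem inner_gaborSystem_eq_integral (f : Lp ℂ 2 (volume : Measure ℝ)) (a : ℝ) (l k : ℤ) :
    Integrable (fun x : ℝ => Complex.exp (-(3 * Real.pi * Complex.I * l * x)) *
        (f x * B₂ (x - k * a))) ∧
      inner ℂ (gaborSystem B₂ B₂_memLp a (3 / 2) (l, k)) f =
        ∫ x : ℝ, Complex.exp (-(3 * Real.pi * Complex.I * l * x)) * (f x * B₂ (x - k * a)) := by
  have hae : (fun x : ℝ => inner ℂ (gaborSystem B₂ B₂_memLp a (3 / 2) (l, k) x) (f x)) =ᵐ[volume]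
      fun x : ℝ => Complex.exp (-(3 * Real.pi * Complex.I * l * x)) * (f x * B₂ (x - k * a)) := by
    filter_upwards [(timeFreqShift_memLp B₂_memLp (l * (3 / 2)) (k * a)).coeFn_toLp] with x hx
    rw [gaborSystem, hx, RCLike.inner_apply, timeFreqShift, map_mul, ← Complex.exp_conj, B₂,
      Complex.conj_ofReal]
    have : (starRingEnd ℂ) (2 * Real.pi * Complex.I * ((l * (3 / 2) : ℝ) : ℂ) * x) =
        -(3 * Real.pi * Complex.I * l * x) := by
      simp only [map_mul, Complex.conj_ofReal, Complex.conj_I, Complex.conj_ofNat]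
      push_cast
      ring
    rw [this]
    ring
  exact ⟨(L2.integrable_inner _ f).congr hae, by rw [L2.inner_def, integral_congr_ae hae]⟩

theorem exp_add_two_thirds (l : ℤ) (x : ℝ) :
    Complex.exp (-(3 * Real.pi * Complex.I * l * ((x + 2 / 3 : ℝ) : ℂ))) =
      Complex.exp (-(3 * Real.pi * Complex.I * l * x)) := by
  rw [Complex.exp_eq_exp_iff_exists_int]
  refine ⟨-l, ?_⟩
  push_cast
  ring

/-- The support of the integrand is cut into three periods, whose outer two are folded onto the
central one; the exponential is unaffected. The factor 2/3 undoes the normalization of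
`fourierCoeffOn`. -/
theorem inner_gaborSystem (f : Lp ℂ 2 (volume : Measure ℝ)) (a : ℝ) (l k : ℤ) :
    inner ℂ (gaborSystem B₂ B₂_memLp a (3 / 2) (l, k)) f =
      (2 / 3 : ℂ) * fourierCoeffOn (third_interval_lt (k * a)) (fiberSum f (k * a)) l := by
  obtain ⟨hint, heq⟩ := inner_gaborSystem_eq_integral f a l k
  rw [heq]
  obtain ⟨s, hs⟩ : ∃ s : ℝ, s = k * a := ⟨_, rfl⟩
  simp only [← hs] at hint ⊢
  obtain ⟨E, hE⟩ : ∃ E : ℝ → ℂ, E = fun x : ℝ => Complex.exp (-(3 * Real.pi * Complex.I * l * x)) :=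
    ⟨_, rfl⟩
  obtain ⟨G, hG⟩ : ∃ G : ℝ → ℂ, G = fun x : ℝ => E x * (f x * B₂ (x - s)) := ⟨_, rfl⟩
  have hEper : Function.Periodic E (2 / 3) := fun x => by
    rw [hE]
    exact exp_add_two_thirds l x
  have hGint : Integrable G := by
    rw [hG, hE]
    exact hint
  have hsupp : Function.support G ⊆ Set.Ioc (s - 1) (s + 1) := by
    intro x hx
    have hx' : |x - s| < 1 := by
      by_contra h
      refine hx ?_
      rw [hG]
      simp only [B₂_of_one_le_abs (not_lt.1 h), mul_zero]
    obtain ⟨h1, h2⟩ := abs_lt.1 hx'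
    exact ⟨by linarith, by linarith⟩
  have hgoal : ∫ x : ℝ, Complex.exp (-(3 * Real.pi * Complex.I * l * x)) * (f x * B₂ (x - s)) =
      ∫ x, G x := by rw [hG, hE]
  have hii : ∀ c d : ℝ, IntervalIntegrable G volume c d := fun c d => hGint.intervalIntegrable
  have hsm : Integrable fun x => G (x - 2 / 3) := hGint.comp_sub_right _
  have hsp : Integrable fun x => G (x + 2 / 3) := hGint.comp_add_right _
  have hm : ∫ x in (s - 1)..(s - 1 / 3), G x = ∫ x in (s - 1 / 3)..(s + 1 / 3), G (x - 2 / 3) := by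
    rw [intervalIntegral.integral_comp_sub_right]
    congr 1 <;> ring
  have hp : ∫ x in (s + 1 / 3)..(s + 1), G x = ∫ x in (s - 1 / 3)..(s + 1 / 3), G (x + 2 / 3) := by
    rw [intervalIntegral.integral_comp_add_right]
    congr 1 <;> ring
  rw [hgoal, ← intervalIntegral.integral_eq_integral_of_support_subset hsupp,
    ← intervalIntegral.integral_add_adjacent_intervals (hii _ (s + 1 / 3)) (hii _ _),
    ← intervalIntegral.integral_add_adjacent_intervals (hii _ (s - 1 / 3)) (hii _ _), hm, hp,
    ← intervalIntegral.integral_add hsm.intervalIntegrable (hii _ _),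
    ← intervalIntegral.integral_add
      (hsm.intervalIntegrable.add (hii _ _)) hsp.intervalIntegrable,
    fourierCoeffOn_eq_integral, Complex.real_smul, third_interval_length, ← mul_assoc]
  have h1 : (2 / 3 : ℂ) * ((1 / (2 / 3) : ℝ) : ℂ) = 1 := by
    push_cast
    norm_num
  rw [h1, one_mul]
  refine intervalIntegral.integral_congr fun x hx => ?_
  rw [Set.uIcc_of_le (third_interval_lt s).le] at hx
  have hfour : fourier (-l) (x : AddCircle (2 / 3 : ℝ)) = E x := by
    rw [fourier_coe_apply, hE]
    congr 1
    push_cast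
    ring
  have e1 : E (x - 2 / 3) = E x := hEper.sub_eq x
  have e2 : E (x + 2 / 3) = E x := hEper x
  simp only [hfour, smul_eq_mul]
  rw [fiberSum_eq_add f (abs_le.2 ⟨by linarith [hx.1], by linarith [hx.2]⟩), hG]
  simp only [e1, e2]
  ring

theorem memLp_fiberSum (f : Lp ℂ 2 (volume : Measure ℝ)) (s : ℝ) :
    MemLp (fiberSum f s) 2 (volume.restrict (Set.Ioc (s - 1 / 3) (s + 1 / 3))) := by
  have hH : MemLp (fun x => f x * B₂ (x - s)) 2 volume := by
    refine (Lp.memLp f).mono ((Lp.memLp f).1.mul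
      (continuous_B₂.comp (continuous_sub_right s)).aestronglyMeasurable) (ae_of_all _ fun x => ?_)
    rw [norm_mul]
    exact mul_le_of_le_one_right (norm_nonneg _) (norm_B₂_le_one _)
  have hsm := hH.comp_measurePreserving (measurePreserving_sub_right volume (2 / 3 : ℝ))
  have hsp := hH.comp_measurePreserving (measurePreserving_add_right volume (2 / 3 : ℝ))
  refine (((hsm.add hH).add hsp).restrict _).ae_eq ?_
  filter_upwards [ae_restrict_mem measurableSet_Ioc] with x hx
  rw [fiberSum_eq_add f (abs_le.2 ⟨by linarith [hx.1], by linarith [hx.2]⟩)]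
  rfl

/-- This is Parseval on a period of length 2/3: the squared factor `(2/3)²` meets `(2/3)⁻¹` from the
normalized energy. -/
theorem tsum_inner_gaborSystem (f : Lp ℂ 2 (volume : Measure ℝ)) (a : ℝ) (k : ℤ) :
    ∑' l : ℤ, ‖inner ℂ (gaborSystem B₂ B₂_memLp a (3 / 2) (l, k)) f‖ₑ ^ 2 =
      ENNReal.ofReal (2 / 3) * fiberEnergy f (k * a) := by
  have hL2 := memLp_fiberSum f (k * a)
  have hsum := hasSum_sq_fourierCoeffOn (third_interval_lt (k * a)) hL2
  have hE : fiberEnergy f (k * a) = ENNReal.ofReal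
      (∫ x in (k * a - 1 / 3)..(k * a + 1 / 3), ‖fiberSum f (k * a) x‖ ^ 2) := by
    rw [intervalIntegral.integral_of_le (third_interval_lt _).le,
      ofReal_integral_eq_lintegral_ofReal (hL2.integrable_norm_pow (by norm_num))
        (ae_of_all _ fun x => by positivity), fiberEnergy]
    simp only [ofReal_norm_sq]
  have hn : ∀ l : ℤ, ‖inner ℂ (gaborSystem B₂ B₂_memLp a (3 / 2) (l, k)) f‖ₑ ^ 2 =
      ENNReal.ofReal ((2 / 3) ^ 2 * ‖fourierCoeffOn (third_interval_lt (k * a))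
        (fiberSum f (k * a)) l‖ ^ 2) := by
    intro l
    rw [← ofReal_norm_sq, inner_gaborSystem, norm_mul, mul_pow]
    norm_num
  simp only [hn]
  rw [← ENNReal.ofReal_tsum_of_nonneg (fun l => by positivity) (hsum.summable.mul_left _),
    tsum_mul_left, hsum.tsum_eq, hE, ← ENNReal.ofReal_mul (by norm_num), third_interval_length,
    smul_eq_mul]
  congr 1
  ring

theorem tsum_inner_gaborSystem_eq (f : Lp ℂ 2 (volume : Measure ℝ)) (a : ℝ) :
    ∑' i : ℤ × ℤ, ‖inner ℂ (gaborSystem B₂ B₂_memLp a (3 / 2) i) f‖ₑ ^ 2 =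
      ENNReal.ofReal (2 / 3) * ∑' k : ℤ, fiberEnergy f (k * a) := by
  rw [ENNReal.tsum_prod', ENNReal.tsum_comm, ← ENNReal.tsum_mul_left]
  exact tsum_congr fun k => tsum_inner_gaborSystem f a k

/-! ### Frame bounds -/

theorem lintegral_enorm_sq_eq (f : Lp ℂ 2 (volume : Measure ℝ)) :
    ∫⁻ x, ‖f x‖ₑ ^ 2 = ENNReal.ofReal (‖f‖ ^ 2) := by
  have h := eLpNorm_nnreal_pow_eq_lintegral (f := f) (μ := (volume : Measure ℝ)) (p := 2)
    two_ne_zero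
  rw [ENNReal.ofReal_pow (norm_nonneg f), ofReal_norm, Lp.enorm_def]
  simpa using h.symm

theorem isFrame_of_tsum_bounds {ι H : Type*} [NormedAddCommGroup H] [InnerProductSpace ℂ H]
    {e : ι → H} {C D : ENNReal} (hC : C ≠ ⊤) (hD : D ≠ ⊤)
    (hlow : ∀ f : H, ENNReal.ofReal (‖f‖ ^ 2) ≤ C * ∑' i, ‖inner ℂ (e i) f‖ₑ ^ 2)
    (hup : ∀ f : H, ∑' i, ‖inner ℂ (e i) f‖ₑ ^ 2 ≤ D * ENNReal.ofReal (‖f‖ ^ 2)) :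
    IsFrame e := by
  -- Adding 1 keeps both frame constants positive even if `C` or `D` is 0.
  refine ⟨(C.toReal + 1)⁻¹, D.toReal + 1, by positivity, by positivity, fun f => ?_⟩
  have hfin : ∑' i, ‖inner ℂ (e i) f‖ₑ ^ 2 ≠ ⊤ :=
    ne_top_of_le_ne_top (ENNReal.mul_ne_top hD ENNReal.ofReal_ne_top) (hup f)
  have hreal : ∀ i, (‖inner ℂ (e i) f‖ₑ ^ 2).toReal = ‖inner ℂ (e i) f‖ ^ 2 := fun i => by
    rw [ENNReal.toReal_pow, toReal_enorm]
  have hsum : Summable fun i => ‖inner ℂ (e i) f‖ ^ 2 := by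
    simpa only [hreal] using ENNReal.summable_toReal hfin
  have htsum : (∑' i, ‖inner ℂ (e i) f‖ₑ ^ 2).toReal = ∑' i, ‖inner ℂ (e i) f‖ ^ 2 := by
    rw [ENNReal.tsum_toReal_eq fun i => ENNReal.ne_top_of_tsum_ne_top hfin i]
    exact tsum_congr hreal
  have h0 : 0 ≤ ∑' i, ‖inner ℂ (e i) f‖ ^ 2 := tsum_nonneg fun i => by positivity
  have hf0 : 0 ≤ ‖f‖ ^ 2 := by positivity
  have h1 := ENNReal.toReal_mono (ENNReal.mul_ne_top hC hfin) (hlow f)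
  have h2 := ENNReal.toReal_mono (ENNReal.mul_ne_top hD ENNReal.ofReal_ne_top) (hup f)
  rw [ENNReal.toReal_mul, htsum, ENNReal.toReal_ofReal hf0] at h1
  rw [ENNReal.toReal_mul, htsum, ENNReal.toReal_ofReal hf0] at h2
  refine ⟨hsum, ?_, by linarith⟩
  rw [inv_mul_le_iff₀ (by positivity)]
  linarith

/-- Local recovery for the step `n * a` gives the frame property for the finer step `a`. -/
theorem LocallyRecoverable.isFrame {a : ℝ} {n : ℕ} (hn : n ≠ 0) (ha : 0 < a)
    (h : LocallyRecoverable (n * a)) : IsFrame (gaborSystem B₂ B₂_memLp a (3 / 2)) := by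
  obtain ⟨C, hC, hlow⟩ := h.lintegral_le
  obtain ⟨D, hD, hup⟩ := tsum_fiberEnergy_le ha
  refine isFrame_of_tsum_bounds (C := C * ENNReal.ofReal (3 / 2)) (D := ENNReal.ofReal (2 / 3) * D)
    (ENNReal.mul_ne_top hC ENNReal.ofReal_ne_top) (ENNReal.mul_ne_top ENNReal.ofReal_ne_top hD)
    (fun f => ?_) fun f => ?_
  · have hinj : Function.Injective fun k : ℤ => (n : ℤ) * k := fun i j hij =>
      mul_left_cancel₀ (Nat.cast_ne_zero.2 hn) hij
    have hsub : ∑' k : ℤ, fiberEnergy f (k * (n * a)) ≤ ∑' k : ℤ, fiberEnergy f (k * a) := by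
      refine le_trans (le_of_eq (tsum_congr fun k => ?_))
        (ENNReal.tsum_comp_le_tsum_of_injective hinj fun k : ℤ => fiberEnergy f (k * a))
      congr 1
      push_cast
      ring
    rw [tsum_inner_gaborSystem_eq, ← lintegral_enorm_sq_eq, mul_assoc,
      ← mul_assoc (ENNReal.ofReal (3 / 2)), ← ENNReal.ofReal_mul (by norm_num)]
    norm_num
    exact (hlow f (Lp.stronglyMeasurable f).measurable).trans (by gcongr)
  · rw [tsum_inner_gaborSystem_eq, ← lintegral_enorm_sq_eq, mul_assoc]
    gcongr
    exact hup f (Lp.stronglyMeasurable f).measurable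

theorem mainTheorem2 :
    (∀ j : ℕ, 1 ≤ j → IsFrame (gaborSystem B₂ B₂_memLp (1 / 2 ^ j) (3 / 2))) ∧
    (∀ j : ℕ, 3 ≤ j → IsFrame (gaborSystem B₂ B₂_memLp (3 / 2 ^ j) (3 / 2))) := by
  refine ⟨fun j hj => ?_, fun j hj => ?_⟩
  · obtain ⟨i, rfl⟩ := Nat.exists_eq_add_of_le hj
    refine LocallyRecoverable.isFrame (n := 2 ^ i) (by positivity) (by positivity) ?_
    convert locallyRecoverable_half using 1
    push_cast
    field_simp
    ring
  · obtain ⟨i, rfl⟩ := Nat.exists_eq_add_of_le hj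
    refine LocallyRecoverable.isFrame (n := 2 ^ i) (by positivity) (by positivity) ?_
    convert locallyRecoverable_three_eighths using 1
    push_cast
    field_simp
    ring

end
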